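/- Theorem 1.1. All graphs are finite and simple. For a graph $F$ let $\mathrm{ex}(n,F)$ be the maximum number of edges of an $n$-vertex graph containing no (not necessarily induced) copy of $F$, and let $\mathrm{EX}(n,F)$ be the set of $n$-vertex $F$-free graphs with $\mathrm{ex}(n,F)$ edges. Let $T_{n,r}$ be the complete $r$-partite graph on $n$ vertices with part sizes as equal as possible, $e(G)$ the number of edges of $G$, $kF$ the disjoint union of $k$ copies of $F$, $K_m$ the complete graph on $m$ vertices ($K_0$ being empty), and $G\vee H$ the join of $G$ and $H$. Let $r\ge 2$ and $k\ge 1$ be integers, and let $F$ be a graph with $\mathrm{ex}(n,F)=e(T_{n,r})+O(1)$ as $n\to\infty$. Then there is $n_0=n_0(F,r,k)$ such that for every $n\ge n_0$ and every $n$-vertex graph $G$: $G\in\mathrm{EX}(n,kF)$ if and only if $G\cong K_{k-1}\vee H$ for some $H\in\mathrm{EX}(n-k+1,F)$. -/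

import Mathlib

open Filter Asymptotics

namespace SimpleGraph

/-- `k` pairwise vertex-disjoint copies of `F`: two vertices are adjacent when they lie in the
same copy and are adjacent in `F`. -/
def disjointCopies {W : Type*} (k : ℕ) (F : SimpleGraph W) : SimpleGraph (Fin k × W) where
  Adj x y := x.1 = y.1 ∧ F.Adj x.2 y.2
  symm := ⟨fun _ _ h => ⟨h.1.symm, h.2.symm⟩⟩
  loopless := ⟨fun x h => F.irrefl h.2⟩

/-- The join of `G` and `H`: their disjoint union together with all edges between
the vertices of `G` and the vertices of `H`. -/
def graphJoin {V W : Type*} (G : SimpleGraph V) (H : SimpleGraph W) : SimpleGraph (V ⊕ W) :=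
  (G ⊕g H) ⊔ completeBipartiteGraph V W

open scoped Classical in
/-- The set of graphs with the maximum number of edges among all `F`-free graphs on the
vertex set `Fin n`. -/
def extremalGraphs {W : Type*} (n : ℕ) (F : SimpleGraph W) : Set (SimpleGraph (Fin n)) :=
  {G | G.IsExtremal F.Free}

end SimpleGraph

/-! Write p = 1 - 1/r. The hypothesis gives ex(n, F) = pn²/2 + O(1) with no linear term, and the
proof compares linear terms. Adding a dominating vertex to T_{n,r} adds n edges, while ex grows only
by pn + O(1); so F lies in the join of a vertex and a complete r-partite graph
(`exists_isContained_graphJoin_completeEquipartiteGraph`).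

Dominating vertices are peeled off one at a time. Let G be (j+2)F-free with at least n - 1 + ex(n-1,
(j+1)F) edges. A bounded set meets all copies of F, yet the edge count exceeds pn²/2 by about
(1-p)n, which forces a vertex v of degree at least (p+ε)n (`exists_le_degOn`). Given a bounded set R
missing v, almost all vertices outside R span a graph of minimum degree nearly pn; the neighbours of
v there are dense enough for Erdős–Stone to give a complete r-partite graph, which with v contains F
(`eventually_isContained_induce_compl`). If G - v contained (j+1)F, taking R as its vertex set would
produce (j+2)F. So G - v is (j+1)F-free, and e(G) = e(G-v) + deg v forces v to be dominating and G -
v to be extremal. -/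

namespace SimpleGraph

/-! ### Degrees and degree sums relative to vertex subsets. -/

section DegreeSums

variable {V : Type*} (G : SimpleGraph V)

open scoped Classical in
/-- The number of neighbours of `x` in the finite set `A`. -/
noncomputable def degOn (A : Finset V) (x : V) : ℕ := (A.filter (G.Adj x)).card

/-- The sum of the degrees of the subgraph induced by the finite set `A`. -/
noncomputable def degSum (A : Finset V) : ℕ := ∑ x ∈ A, G.degOn A x

lemma degOn_mono {A B : Finset V} (h : A ⊆ B) (x : V) : G.degOn A x ≤ G.degOn B x := by
  classical
  exact Finset.card_le_card (Finset.filter_subset_filter _ h)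

lemma degOn_le_add_card_sdiff [DecidableEq V] (A B : Finset V) (x : V) :
    G.degOn A x ≤ G.degOn B x + (A \ B).card := by
  classical
  refine (Finset.card_le_card fun y hy => ?_).trans (Finset.card_union_le _ _)
  rw [Finset.mem_filter] at hy
  by_cases hB : y ∈ B
  · exact Finset.mem_union_left _ (Finset.mem_filter.2 ⟨hB, hy.2⟩)
  · exact Finset.mem_union_right _ (Finset.mem_sdiff.2 ⟨hy.1, hB⟩)

lemma degOn_eq_sum [DecidableRel G.Adj] (A : Finset V) (x : V) :
    G.degOn A x = ∑ y ∈ A, if G.Adj x y then 1 else 0 := by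
  rw [degOn, Finset.card_filter]
  congr!

lemma degOn_insert [DecidableEq V] [DecidableRel G.Adj] {A : Finset V} {a : V} (ha : a ∉ A)
    (x : V) : G.degOn (insert a A) x = (if G.Adj x a then 1 else 0) + G.degOn A x := by
  rw [degOn_eq_sum, degOn_eq_sum, Finset.sum_insert ha]

lemma degSum_insert [DecidableEq V] {A : Finset V} {a : V} (ha : a ∉ A) :
    G.degSum (insert a A) = G.degSum A + 2 * G.degOn A a := by
  classical
  have hsymm : ∑ x ∈ A, (if G.Adj x a then 1 else 0) = G.degOn A a := by
    rw [degOn_eq_sum]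
    exact Finset.sum_congr rfl fun x _ => by simp [G.adj_comm]
  have hA : ∑ x ∈ A, G.degOn (insert a A) x = G.degOn A a + G.degSum A := by
    rw [← hsymm, degSum, ← Finset.sum_add_distrib]
    exact Finset.sum_congr rfl fun x _ => G.degOn_insert ha x
  rw [degSum, Finset.sum_insert ha, hA, G.degOn_insert ha]
  simp
  omega

lemma degSum_erase [DecidableEq V] {A : Finset V} {a : V} (ha : a ∈ A) :
    G.degSum A = G.degSum (A.erase a) + 2 * G.degOn A a := by
  classical
  have h := G.degSum_insert (Finset.notMem_erase a A)
  have h' := G.degOn_insert (Finset.notMem_erase a A) a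
  rw [Finset.insert_erase ha] at h h'
  simp only [SimpleGraph.irrefl, if_false] at h'
  rw [h, h']
  omega

/-- Deleting the vertices of S one by one costs at most 2d each, because degrees only drop as the
set shrinks. -/
lemma degSum_le_sdiff [DecidableEq V] (A S : Finset V) {d : ℝ} (hd : 0 ≤ d)
    (h : ∀ x ∈ S, (G.degOn A x : ℝ) ≤ d) :
    (G.degSum A : ℝ) ≤ G.degSum (A \ S) + 2 * S.card * d := by
  induction S using Finset.induction with
  | empty => simp
  | insert a S ha ih =>
    have ih' := ih fun x hx => h x (Finset.mem_insert_of_mem hx)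
    have ha' := h a (Finset.mem_insert_self a S)
    rw [Finset.sdiff_insert, Finset.card_insert_of_notMem ha]
    push_cast
    by_cases hmem : a ∈ A \ S
    · have h1 : (G.degSum (A \ S) : ℝ) = G.degSum ((A \ S).erase a) + 2 * G.degOn (A \ S) a := by
        exact_mod_cast G.degSum_erase hmem
      have h2 : (G.degOn (A \ S) a : ℝ) ≤ G.degOn A a := by
        exact_mod_cast G.degOn_mono Finset.sdiff_subset a
      linarith
    · rw [Finset.erase_eq_of_notMem hmem]
      linarith

lemma degOn_univ [Fintype V] [DecidableRel G.Adj] (x : V) :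
    G.degOn Finset.univ x = G.degree x := by
  rw [degOn, ← card_neighborFinset_eq_degree, neighborFinset_eq_filter]
  congr!

lemma degSum_univ [Fintype V] [DecidableRel G.Adj] :
    G.degSum Finset.univ = 2 * G.edgeFinset.card := by
  rw [← sum_degrees_eq_twice_card_edges, degSum]
  exact Finset.sum_congr rfl fun x _ => G.degOn_univ x

lemma degOn_comap {U : Type*} [Fintype U] (f : U ↪ V) (x : U) :
    (G.comap f).degOn Finset.univ x = G.degOn (Finset.univ.map f) (f x) := by
  classical
  rw [degOn_eq_sum, degOn_eq_sum, Finset.sum_map]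
  simp

lemma degSum_comap {U : Type*} [Fintype U] (f : U ↪ V) :
    (G.comap f).degSum Finset.univ = G.degSum (Finset.univ.map f) := by
  rw [degSum, degSum, Finset.sum_map]
  exact Finset.sum_congr rfl fun x _ => G.degOn_comap f x

lemma degSum_le_extremalNumber {W : Type*} {F : SimpleGraph W} {A : Finset V}
    (h : F.Free (G.induce (A : Set V))) : G.degSum A ≤ 2 * extremalNumber A.card F := by
  classical
  have hA : Finset.univ.map (Function.Embedding.subtype (· ∈ A)) = A := by
    ext x; simp
  have h1 := G.degSum_comap (Function.Embedding.subtype (· ∈ A))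
  rw [hA, degSum_univ] at h1
  have h2 := card_edgeFinset_le_extremalNumber h
  simp only [Finset.coe_sort_coe, Fintype.card_coe] at h2
  rw [← h1]
  refine Nat.mul_le_mul_left 2 (le_of_eq_of_le ?_ h2)
  congr!

end DegreeSums

/-! ### Disjoint copies, and bounded sets meeting every copy. -/

section Copies

variable {V W : Type*} {F : SimpleGraph W} {G : SimpleGraph V}

lemma IsContained.induce_mono {s t : Set V} (h : F ⊑ G.induce s) (hst : s ⊆ t) :
    F ⊑ G.induce t :=
  h.trans (induceHomOfLE G hst).isContained

lemma isContained_induce_iff {s : Set V} :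
    F ⊑ G.induce s ↔ ∃ f : Copy F G, ∀ w, f w ∈ s := by
  constructor
  · rintro ⟨f⟩
    exact ⟨(Copy.induce G s).comp f, fun w => (f w).2⟩
  · rintro ⟨f, hf⟩
    exact ⟨⟨⟨fun w => ⟨f w, hf w⟩, fun h => f.toHom.map_adj h⟩,
      fun a b hab => f.injective (congrArg Subtype.val hab)⟩⟩

/-- A copy of `k` disjoint copies of `F` and a copy of `F` on disjoint sets give `k + 1` disjoint
copies. -/
lemma disjointCopies_succ_isContained {k : ℕ} {s t : Set V} (hst : Disjoint s t)
    (hs : F ⊑ G.induce s) (ht : disjointCopies k F ⊑ G.induce t) :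
    disjointCopies (k + 1) F ⊑ G := by
  obtain ⟨f, hf⟩ := isContained_induce_iff.1 hs
  obtain ⟨g, hg⟩ := isContained_induce_iff.1 ht
  let φ : Fin (k + 1) × W → V := fun x => Fin.cases (f x.2) (fun i => g (i, x.2)) x.1
  have h0 (w) : φ (0, w) = f w := rfl
  have h1 (i w) : φ (Fin.succ i, w) = g (i, w) := rfl
  have hne (a b) : f a ≠ g b := fun h => Set.disjoint_left.1 hst (hf a) (h ▸ hg b)
  refine ⟨⟨⟨φ, ?_⟩, ?_⟩⟩
  · rintro ⟨i, a⟩ ⟨j, b⟩ ⟨hij, hab⟩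
    obtain rfl : i = j := hij
    cases i using Fin.cases with
    | zero => exact f.toHom.map_adj hab
    | succ i => exact g.toHom.map_adj (show (disjointCopies k F).Adj (i, a) (i, b) from ⟨rfl, hab⟩)
  · rintro ⟨i, a⟩ ⟨j, b⟩ hab
    change φ (i, a) = φ (j, b) at hab
    cases i using Fin.cases with
    | zero =>
      cases j using Fin.cases with
      | zero => rw [h0, h0] at hab; rw [f.injective hab]
      | succ j => rw [h0, h1] at hab; exact absurd hab (hne _ _)
    | succ i =>
      cases j using Fin.cases with
      | zero => rw [h0, h1] at hab; exact absurd hab.symm (hne _ _)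
      | succ j =>
        rw [h1, h1] at hab
        have := g.injective hab
        simp only [Prod.mk.injEq] at this ⊢
        exact ⟨congrArg _ this.1, this.2⟩

/-- A vertex meets at most one of `k + 1` disjoint copies. -/
lemma disjointCopies_isContained_induce_compl_singleton {k : ℕ}
    (h : disjointCopies (k + 1) F ⊑ G) (v : V) :
    disjointCopies k F ⊑ G.induce {v}ᶜ := by
  obtain ⟨f⟩ := h
  obtain ⟨i, hi⟩ : ∃ i, ∀ j, j ≠ i → ∀ w, f (j, w) ≠ v := by
    by_cases hv : ∃ i w, f (i, w) = v
    · obtain ⟨i, w, rfl⟩ := hv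
      exact ⟨i, fun j hj w' h => hj (Prod.ext_iff.1 (f.injective h)).1⟩
    · push Not at hv
      exact ⟨0, fun j _ => hv j⟩
  refine isContained_induce_iff.2 ⟨⟨⟨fun x => f (i.succAbove x.1, x.2), ?_⟩, ?_⟩, ?_⟩
  · rintro ⟨j, a⟩ ⟨j', b⟩ ⟨hj, hab⟩
    obtain rfl : j = j' := hj
    exact f.toHom.map_adj
      (show (disjointCopies (k + 1) F).Adj (i.succAbove j, a) (i.succAbove j, b) from ⟨rfl, hab⟩)
  · rintro ⟨j, a⟩ ⟨j', b⟩ hab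
    have := f.injective hab
    simp only [Prod.mk.injEq, Fin.succAbove_right_inj] at this ⊢
    exact this
  · exact fun x => hi _ (Fin.succAbove_ne i x.1) x.2

/-- Makes ex(n, F) a lower bound for ex(n, (k+1)F). -/
lemma isContained_disjointCopies_succ (k : ℕ) : F ⊑ disjointCopies (k + 1) F :=
  ⟨⟨⟨fun w => (0, w), fun h => ⟨rfl, h⟩⟩, fun _ _ h => (Prod.ext_iff.1 h).2⟩⟩

/-- One copy of `F` is `F`. -/
def disjointCopiesOneIso (F : SimpleGraph W) : disjointCopies 1 F ≃g F where
  toEquiv := Equiv.uniqueProd W (Fin 1)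
  map_rel_iff' {x y} := by
    simp [disjointCopies, Subsingleton.elim x.1 y.1]

/-- A finite set of vertices containing the image of a copy of a finite graph. -/
lemma IsContained.exists_finset [Fintype W] {s : Set V} (h : F ⊑ G.induce s) :
    ∃ A : Finset V, (A : Set V) ⊆ s ∧ A.card ≤ Fintype.card W ∧ F ⊑ G.induce (A : Set V) := by
  classical
  obtain ⟨f, hf⟩ := isContained_induce_iff.1 h
  refine ⟨Finset.univ.image f, ?_, Finset.card_image_le, isContained_induce_iff.2 ⟨f, ?_⟩⟩
  · intro x hx
    obtain ⟨w, -, rfl⟩ := Finset.mem_image.1 hx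
    exact hf w
  · simp

/-- In a graph without `k` disjoint copies of `F`, boundedly many vertices meet all copies. -/
lemma exists_finset_free_induce_compl [Fintype W] (k : ℕ) (s : Set V)
    (h : (disjointCopies k F).Free (G.induce s)) :
    ∃ S : Finset V, S.card ≤ k * Fintype.card W ∧ F.Free (G.induce (s \ S)) := by
  classical
  induction k generalizing s with
  -- Zero copies form a graph without vertices, contained in everything.
  | zero => exact absurd IsContained.of_isEmpty h
  | succ k ih =>
    by_cases hF : F.Free (G.induce s)
    · exact ⟨∅, by simp, by rwa [Finset.coe_empty, Set.sdiff_empty]⟩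
    · obtain ⟨A, hAs, hAc, hA⟩ := IsContained.exists_finset (not_free.1 hF)
      -- Greedy choice: k copies outside A, together with the copy on A, would be k + 1 copies.
      obtain ⟨S, hSc, hS⟩ := ih (s \ A) fun hc => h <| by
        obtain ⟨f, hf⟩ := isContained_induce_iff.1 hA
        obtain ⟨g, hg⟩ := isContained_induce_iff.1 hc
        refine disjointCopies_succ_isContained (s := Subtype.val ⁻¹' (A : Set V))
          (t := Subtype.val ⁻¹' (s \ A : Set V)) ?_ ?_ ?_
        · exact Disjoint.preimage _ Set.disjoint_sdiff_right
        · exact isContained_induce_iff.2 ⟨⟨⟨fun w => ⟨f w, hAs (hf w)⟩,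
            fun h => f.toHom.map_adj h⟩, fun a b hab => f.injective (congrArg Subtype.val hab)⟩, hf⟩
        · exact isContained_induce_iff.2 ⟨⟨⟨fun w => ⟨g w, (hg w).1⟩,
            fun h => g.toHom.map_adj h⟩, fun a b hab => g.injective (congrArg Subtype.val hab)⟩, hg⟩
      refine ⟨A ∪ S, (Finset.card_union_le _ _).trans (by linarith), ?_⟩
      rwa [Finset.coe_union, ← Set.sdiff_sdiff]

end Copies

/-! ### Joins and dominating vertices. -/

section Join

variable {U V W : Type*}

@[simp] lemma graphJoin_adj_inl {G : SimpleGraph V} {H : SimpleGraph W} {a b : V} :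
    (graphJoin G H).Adj (.inl a) (.inl b) ↔ G.Adj a b := by simp [graphJoin]

@[simp] lemma graphJoin_adj_inr {G : SimpleGraph V} {H : SimpleGraph W} {a b : W} :
    (graphJoin G H).Adj (.inr a) (.inr b) ↔ H.Adj a b := by simp [graphJoin]

@[simp] lemma graphJoin_adj_inl_inr {G : SimpleGraph V} {H : SimpleGraph W} {a : V} {b : W} :
    (graphJoin G H).Adj (.inl a) (.inr b) := by simp [graphJoin]

@[simp] lemma graphJoin_adj_inr_inl {G : SimpleGraph V} {H : SimpleGraph W} {a : V} {b : W} :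
    (graphJoin G H).Adj (.inr b) (.inl a) := by simp [graphJoin]

/-- Joins of isomorphic graphs are isomorphic. -/
def graphJoinCongr {V' W' : Type*} {G : SimpleGraph V} {G' : SimpleGraph V'} {H : SimpleGraph W}
    {H' : SimpleGraph W'} (e : G ≃g G') (e' : H ≃g H') : graphJoin G H ≃g graphJoin G' H' where
  toEquiv := Equiv.sumCongr e.toEquiv e'.toEquiv
  map_rel_iff' {x y} := by
    rcases x with x | x <;> rcases y with y | y <;> simp
    exacts [e.map_adj_iff, e'.map_adj_iff]

/-- The join is associative. -/
def graphJoinAssoc (G : SimpleGraph U) (H : SimpleGraph V) (K : SimpleGraph W) :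
    graphJoin (graphJoin G H) K ≃g graphJoin G (graphJoin H K) where
  toEquiv := Equiv.sumAssoc U V W
  map_rel_iff' {x y} := by
    rcases x with (x | x) | x <;> rcases y with (y | y) | y <;> simp

lemma graphJoin_top : graphJoin (⊤ : SimpleGraph V) (⊤ : SimpleGraph W) = ⊤ := by
  ext x y
  rcases x with x | x <;> rcases y with y | y <;> simp

/-- The join of a complete graph on one vertex and one on `k` vertices. -/
def graphJoinTopFinIso (k : ℕ) :
    graphJoin (⊤ : SimpleGraph (Fin 1)) (⊤ : SimpleGraph (Fin k)) ≃g
      (⊤ : SimpleGraph (Fin (k + 1))) :=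
  (graphJoin_top (V := Fin 1) (W := Fin k)) ▸
    Iso.completeGraph (finSumFinEquiv.trans (finCongr (Nat.add_comm 1 k)))

/-- Joining with the graph on no vertices changes nothing. -/
def graphJoinEmptyIso [IsEmpty V] (G : SimpleGraph V) (H : SimpleGraph W) :
    graphJoin G H ≃g H where
  toEquiv := Equiv.emptySum V W
  map_rel_iff' {x y} := by
    rcases x with x | x
    · exact isEmptyElim x
    · rcases y with y | y
      · exact isEmptyElim y
      · simp

/-- `G` is the join of a vertex and `H` exactly when it has a vertex adjacent to all others whose
deletion leaves `H`. -/
lemma nonempty_iso_graphJoin_one_iff {G : SimpleGraph V} {H : SimpleGraph W} :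
    Nonempty (G ≃g graphJoin (⊤ : SimpleGraph (Fin 1)) H) ↔
      ∃ v, (∀ w, w ≠ v → G.Adj v w) ∧ Nonempty (G.induce {v}ᶜ ≃g H) := by
  classical
  constructor
  · rintro ⟨e⟩
    have hr (w) (hw : w ≠ e.symm (.inl 0)) : ∃ b, e w = .inr b := by
      rcases h : e w with a | b
      · refine absurd ?_ hw
        rw [← e.symm_apply_apply w, h, Subsingleton.elim a 0]
      · exact ⟨b, rfl⟩
    refine ⟨e.symm (.inl 0), fun w hw => ?_, ⟨RelIso.symm ⟨Equiv.ofBijective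
      (fun b : W => (⟨e.symm (.inr b), by simp⟩ : ({e.symm (.inl 0)}ᶜ : Set V))) ⟨?_, ?_⟩, ?_⟩⟩⟩
    · obtain ⟨b, hb⟩ := hr w hw
      rw [← e.map_adj_iff, hb]
      simp
    · intro a b hab
      simpa using hab
    · rintro ⟨w, hw⟩
      obtain ⟨b, hb⟩ := hr w hw
      exact ⟨b, by simp [← hb]⟩
    · intro a b
      have : (graphJoin (⊤ : SimpleGraph (Fin 1)) H).Adj (.inr a) (.inr b) ↔ H.Adj a b := by simp
      exact e.symm.map_adj_iff.trans this
  · rintro ⟨v, hv, ⟨e⟩⟩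
    refine ⟨RelIso.symm ⟨⟨Sum.elim (fun _ => v) (fun b => (e.symm b).1),
      fun w => if h : w = v then .inl 0 else .inr (e ⟨w, h⟩), ?_, ?_⟩, ?_⟩⟩
    · rintro (a | b)
      · simp [Subsingleton.elim a 0]
      · have : (e.symm b).1 ≠ v := (e.symm b).2
        simp [this]
    · intro w
      by_cases h : w = v <;> simp [h]
    · rintro (a | a) (b | b)
      · simp [Subsingleton.elim a b]
      · simpa using hv _ (e.symm b).2
      · simpa using (hv _ (e.symm a).2).symm
      · have : G.Adj (e.symm a) (e.symm b) ↔ (G.induce {v}ᶜ).Adj (e.symm a) (e.symm b) := Iff.rfl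
        simp only [Equiv.coe_fn_mk, Sum.elim_inr, graphJoin_adj_inr, this]
        exact e.symm.map_adj_iff

lemma card_edgeFinset_eq_induce_add_degree [Fintype V] [DecidableEq V] (G : SimpleGraph V)
    [DecidableRel G.Adj] (v : V) [Fintype (G.induce {v}ᶜ).edgeSet] :
    G.edgeFinset.card = (G.induce {v}ᶜ).edgeFinset.card + G.degree v := by
  have h := G.card_edgeFinset_induce_compl_singleton v
  rw [card_edgeFinset_deleteIncidenceSet] at h
  have h' : G.degree v ≤ G.edgeFinset.card := by
    rw [← card_incidenceFinset_eq_degree]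
    exact Finset.card_le_card (G.incidenceFinset_subset v)
  have h'' : (G.induce {v}ᶜ).edgeFinset.card = G.edgeFinset.card - G.degree v := by
    rw [← h]; congr!
  omega

lemma degree_eq_card_sub_one_iff [Fintype V] (G : SimpleGraph V)
    [DecidableRel G.Adj] (v : V) :
    G.degree v = Fintype.card V - 1 ↔ ∀ w, w ≠ v → G.Adj v w := by
  classical
  have hsub : G.neighborFinset v ⊆ Finset.univ.erase v := fun w hw => by
    simpa using ((G.mem_neighborFinset v w).1 hw).ne'
  have hc : (Finset.univ.erase v).card = Fintype.card V - 1 := by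
    rw [Finset.card_erase_of_mem (Finset.mem_univ v), Finset.card_univ]
  rw [← card_neighborFinset_eq_degree, ← hc]
  constructor
  · intro h w hw
    have := Finset.eq_of_subset_of_card_le hsub h.ge
    exact (G.mem_neighborFinset v w).1 (this ▸ by simpa using hw)
  · intro h
    congr 1
    refine hsub.antisymm fun w hw => (G.mem_neighborFinset v w).2 (h w (by simpa using hw))

lemma card_edgeFinset_of_iso_graphJoin_one [Fintype V] [Fintype W] {G : SimpleGraph V}
    {H : SimpleGraph W} [DecidableRel G.Adj] [DecidableRel H.Adj]
    (e : G ≃g graphJoin (⊤ : SimpleGraph (Fin 1)) H) :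
    G.edgeFinset.card = H.edgeFinset.card + Fintype.card W := by
  classical
  obtain ⟨v, hv, ⟨e'⟩⟩ := nonempty_iso_graphJoin_one_iff.1 ⟨e⟩
  have hW : Fintype.card V = Fintype.card W + 1 := by
    rw [Fintype.card_congr e.toEquiv]; simp; omega
  rw [card_edgeFinset_eq_induce_add_degree G v, (degree_eq_card_sub_one_iff G v).2 hv,
    e'.card_edgeFinset_eq, hW]
  simp

end Join


/-! ### Quadratic asymptotics and Erdős–Stone. -/

/-- The number of edges of the Turán graph, up to a bounded error. -/
lemma abs_card_edgeFinset_turanGraph_sub_le {r : ℕ} (hr : 0 < r) (n : ℕ) :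
    |((turanGraph n r).edgeFinset.card : ℝ) - (1 - 1 / r) * n ^ 2 / 2| ≤ (r : ℝ) ^ 2 := by
  have hr' : (0 : ℝ) < r := by exact_mod_cast hr
  induction n using Nat.strong_induction_on with
  | _ n ih =>
    -- For n < r both quantities lie between 0 and r²; passing from n to n + r changes both by the
    -- same amount, so the error is periodic.
    rcases lt_or_ge n r with h | h
    · have h1 : 2 * r * ((turanGraph n r).edgeFinset.card : ℝ) ≤ (r - 1) * n ^ 2 := by
        have := mul_card_edgeFinset_turanGraph_le (n := n) (r := r)
        rw [← Nat.cast_pred hr]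
        exact_mod_cast this
      have h2 : ((turanGraph n r).edgeFinset.card : ℝ) ≤ (1 - 1 / r) * n ^ 2 / 2 := by
        rw [show (1 - 1 / (r : ℝ)) * n ^ 2 / 2 = (r - 1) * n ^ 2 / (2 * r) by field_simp,
          le_div_iff₀ (by positivity)]
        linarith
      have h3 : (n : ℝ) ^ 2 ≤ r ^ 2 := by
        have : (n : ℝ) ≤ r := by exact_mod_cast h.le
        gcongr
      have h4 : 0 ≤ 1 / (r : ℝ) * n ^ 2 := by positivity
      have h5 : (0 : ℝ) ≤ (turanGraph n r).edgeFinset.card := by positivity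
      have h6 : (0 : ℝ) ≤ n ^ 2 := by positivity
      rw [abs_le]
      constructor <;> linarith
    · obtain ⟨n, rfl⟩ := Nat.exists_eq_add_of_le' h
      have h1 := ih n (by omega)
      have h2 : (r.choose 2 : ℝ) = r * (r - 1) / 2 := Nat.cast_choose_two ℝ r
      rw [card_edgeFinset_turanGraph_add]
      push_cast
      rw [h2, Nat.cast_pred hr]
      refine le_of_eq_of_le (congrArg _ ?_) h1
      field_simp
      ring

/-- If `ex(n, F)` differs from the Turán number by a bounded amount then it differs from
`(1 - 1 / r) n² / 2` by a bounded amount. -/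
lemma exists_forall_abs_extremalNumber_sub_le {W : Type*} {F : SimpleGraph W} {r : ℕ} (hr : 0 < r)
    (hF : (fun n : ℕ => (extremalNumber n F : ℝ) -
        ((turanGraph n r).edgeFinset.card : ℝ)) =O[atTop] (fun _ => (1 : ℝ))) :
    ∃ C : ℝ, ∀ n : ℕ, |(extremalNumber n F : ℝ) - (1 - 1 / r) * n ^ 2 / 2| ≤ C := by
  obtain ⟨C, hC⟩ := (isBigO_one_nat_atTop_iff).1 hF
  have hbound (n : ℕ) : |(extremalNumber n F : ℝ) - (1 - 1 / r) * n ^ 2 / 2| ≤ C + r ^ 2 :=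
    (abs_sub_le _ _ _).trans (add_le_add (hC n) (abs_card_edgeFinset_turanGraph_sub_le hr n))
  exact ⟨C + r ^ 2, hbound⟩

/-- The minimum-degree form of Erdős–Stone, transported from `Fin` to a vertex subset. -/
lemma exists_completeEquipartiteGraph_isContained_induce (r t : ℕ) {δ : ℝ}
    (hδ : 0 < δ) :
    ∃ N : ℕ, ∀ (V : Type*) (G : SimpleGraph V) (B : Finset V), N ≤ B.card →
      (∀ x ∈ B, (1 - 1 / r + δ) * B.card ≤ (G.degOn B x : ℝ)) →
      completeEquipartiteGraph (r + 1) t ⊑ G.induce (B : Set V) := by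
  classical
  obtain ⟨N, hN⟩ := eventually_atTop.1
    (eventually_completeEquipartiteGraph_isContained_of_minDegree hδ r t)
  refine ⟨N + 1, fun V G B hB hdeg => ?_⟩
  let f : Fin B.card ↪ V := B.equivFin.symm.toEmbedding.trans (Function.Embedding.subtype _)
  have hf : Finset.univ.map f = B := by
    ext x
    simp only [Finset.mem_map, Finset.mem_univ, true_and]
    exact ⟨fun ⟨i, hi⟩ => hi ▸ (B.equivFin.symm i).2,
      fun hx => ⟨B.equivFin ⟨x, hx⟩, by simp [f]⟩⟩
  have : Nonempty (Fin B.card) := ⟨⟨0, by omega⟩⟩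
  refine (hN B.card (by omega) (G := G.comap f) ?_).trans
    (isContained_induce_iff.2 ⟨(Embedding.comap f G).toCopy, fun i => ?_⟩)
  · obtain ⟨i, hi⟩ := (G.comap f).exists_minimal_degree_vertex
    rw [hi, ← degOn_univ, degOn_comap, hf]
    exact hdeg _ (B.equivFin.symm i).2
  · exact (B.equivFin.symm i).2

/-- If `ex(n, F)` is close to the Turán number then `F` is contained in a complete `r`-partite
graph with an additional vertex adjacent to everything. -/
lemma exists_isContained_graphJoin_completeEquipartiteGraph {W : Type*} {F : SimpleGraph W}
    {r : ℕ} (hr : 0 < r) {C : ℝ}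
    (hC : ∀ n : ℕ, |(extremalNumber n F : ℝ) - (1 - 1 / r) * n ^ 2 / 2| ≤ C) :
    ∃ t : ℕ, F ⊑ graphJoin (⊤ : SimpleGraph (Fin 1)) (completeEquipartiteGraph r t) := by
  classical
  have hr' : (0 : ℝ) < r := by exact_mod_cast hr
  -- The dominating vertex gains n/r edges over the growth of ex; n/r must beat the bounded errors.
  obtain ⟨n, hn⟩ := exists_nat_gt (r * (C + r ^ 2 + 1))
  have hn' : C + r ^ 2 + 1 < n / r := by rwa [lt_div_iff₀ hr', mul_comm]
  have hlt : extremalNumber (n + 1) F < (turanGraph n r).edgeFinset.card + n := by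
    have h1 := (abs_le.1 (hC (n + 1))).2
    have h2 := (abs_le.1 (abs_card_edgeFinset_turanGraph_sub_le hr n)).1
    have h3 : (1 - 1 / (r : ℝ)) * ((n + 1 : ℕ) : ℝ) ^ 2 / 2 =
        (1 - 1 / r) * n ^ 2 / 2 + n - n / r + (1 - 1 / r) / 2 := by push_cast; ring
    have h4 : (0 : ℝ) ≤ 1 / r := by positivity
    have : (extremalNumber (n + 1) F : ℝ) < (turanGraph n r).edgeFinset.card + n := by linarith
    exact_mod_cast this
  refine ⟨n, ?_⟩
  have hcont : F ⊑ graphJoin (⊤ : SimpleGraph (Fin 1)) (turanGraph n r) := by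
    apply IsContained.of_extremalNumber_lt_card_edgeFinset
    rw [card_edgeFinset_of_iso_graphJoin_one (H := turanGraph n r) Iso.refl]
    simpa [add_comm 1 n] using hlt
  -- Parts of size n are wasteful, but then i ↦ (i mod r, i) is plainly injective.
  have hT : turanGraph n r ⊑ completeEquipartiteGraph r n :=
    ⟨⟨⟨fun i => (⟨i % r, Nat.mod_lt _ hr⟩, i), fun h => by simpa [turanGraph] using h⟩,
      fun _ _ h => (Prod.ext_iff.1 h).2⟩⟩
  obtain ⟨g⟩ := hT
  refine hcont.trans ⟨⟨⟨Sum.map id g, ?_⟩, ?_⟩⟩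
  · rintro (a | a) (b | b) h
    · simpa using h
    · simp
    · simp
    · rw [graphJoin_adj_inr] at h
      simpa using g.toHom.map_adj h
  · exact Function.injective_id.sumMap g.injective

/-- A copy of `H` inside the neighbourhood of `v` gives a copy of the join of a vertex and `H`. -/
lemma graphJoin_one_isContained_induce_insert {V W : Type*} {G : SimpleGraph V}
    {H : SimpleGraph W} {v : V} {s : Set V} (hs : s ⊆ G.neighborSet v) (h : H ⊑ G.induce s) :
    graphJoin (⊤ : SimpleGraph (Fin 1)) H ⊑ G.induce (insert v s) := by
  obtain ⟨g, hg⟩ := isContained_induce_iff.1 h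
  have hadj (a) : G.Adj v (g a) := hs (hg a)
  refine isContained_induce_iff.2 ⟨⟨⟨Sum.elim (fun _ => v) g, ?_⟩, ?_⟩, ?_⟩
  · rintro (a | a) (b | b) h
    · exact absurd (Subsingleton.elim a b) (by simpa using h)
    · exact hadj b
    · exact (hadj a).symm
    · exact g.toHom.map_adj (by simpa using h)
  · rintro (a | a) (b | b) h
    · rw [Subsingleton.elim a b]
    · exact absurd h (hadj b).ne
    · exact absurd h (hadj a).ne'
    · exact congrArg _ (g.injective h)
  · rintro (a | a)
    · exact Set.mem_insert _ _
    · exact Set.mem_insert_of_mem _ (hg a)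

/-! ### Large minimum degree on almost all vertices, and a vertex of large degree. -/

variable {W : Type*} {F : SimpleGraph W} {p C : ℝ}

lemma degSum_le_of_abs_extremalNumber_sub_le {V : Type*} {G : SimpleGraph V}
    (hC : ∀ n : ℕ, |(extremalNumber n F : ℝ) - p * n ^ 2 / 2| ≤ C) {A : Finset V}
    (hA : F.Free (G.induce (A : Set V))) : (G.degSum A : ℝ) ≤ p * A.card ^ 2 + 2 * C := by
  have h1 : (G.degSum A : ℝ) ≤ 2 * extremalNumber A.card F := by
    exact_mod_cast G.degSum_le_extremalNumber hA
  have h2 := (abs_le.1 (hC A.card)).2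
  linarith

/-- An `F`-free subgraph on almost all vertices contains one of large minimum degree, provided that
the graph has almost the maximum number of edges. -/
lemma exists_subset_forall_le_degOn
    (hC : ∀ n : ℕ, |(extremalNumber n F : ℝ) - p * n ^ 2 / 2| ≤ C) {ε : ℝ} (hε : 0 < ε)
    (hεp : ε ≤ p) (c : ℕ) (K : ℝ) :
    ∃ m : ℕ, ∀ᶠ n : ℕ in atTop, ∀ G : SimpleGraph (Fin n),
      p * n ^ 2 - K * n ≤ G.degSum Finset.univ →
      ∀ S : Finset (Fin n), S.card ≤ c → F.Free (G.induce ((S : Set (Fin n))ᶜ)) →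
      ∃ A : Finset (Fin n), Disjoint A S ∧ n ≤ A.card + m ∧
        ∀ x ∈ A, (p - ε) * n ≤ G.degOn A x := by
  classical
  obtain ⟨m, hm⟩ := exists_nat_ge (max (c : ℝ) ((|K| + 2 * c + 1) / ε))
  have hmc : c ≤ m := by exact_mod_cast (le_max_left _ _).trans hm
  have hmK : |K| + 2 * c + 1 ≤ ε * m := by
    have := (le_max_right _ _).trans hm
    rwa [div_le_iff₀ hε, mul_comm _ ε] at this
  refine ⟨m, ?_⟩
  filter_upwards [eventually_gt_atTop m, tendsto_natCast_atTop_atTop.eventually_gt_atTop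
    (p * m ^ 2 + 2 * C)] with n hnm hn G hG S hS hfree
  -- Removing x from A changes φ by 2((p-ε)n - deg x), so a maximiser that may still shrink has no
  -- vertex of degree below (p-ε)n.
  let φ : Finset (Fin n) → ℝ := fun A => G.degSum A - 2 * (p - ε) * n * A.card
  let P : Finset (Finset (Fin n)) := Sᶜ.powerset.filter fun A => n ≤ A.card + m
  have hSc : n ≤ Sᶜ.card + c := by
    have := Finset.card_add_card_compl S
    rw [Fintype.card_fin] at this
    omega
  have hmem : Sᶜ ∈ P := by
    simp only [P, Finset.mem_filter, Finset.mem_powerset, subset_refl, true_and]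
    omega
  obtain ⟨A, hAP, hmax⟩ := P.exists_max_image φ ⟨_, hmem⟩
  simp only [P, Finset.mem_filter, Finset.mem_powerset] at hAP
  have hdisj : Disjoint A S := by
    rw [← Finset.subset_compl_iff_disjoint_right]; exact hAP.1
  refine ⟨A, hdisj, hAP.2, ?_⟩
  rcases hAP.2.lt_or_eq with hlt | heq
  · intro x hx
    have hcard : ((A.erase x).card : ℝ) = A.card - 1 := by
      have := Finset.card_erase_add_one hx
      rw [← this]; push_cast; ring
    have := hmax (A.erase x) <| by
      simp only [P, Finset.mem_filter, Finset.mem_powerset]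
      refine ⟨(Finset.erase_subset _ _).trans hAP.1, ?_⟩
      have := Finset.card_erase_add_one hx
      omega
    have hsum : (G.degSum A : ℝ) = G.degSum (A.erase x) + 2 * G.degOn A x := by
      exact_mod_cast G.degSum_erase hx
    simp only [φ, hcard, hsum] at this
    nlinarith
  -- A maximiser of the least size n - m is impossible: comparing φ with its value at Sᶜ, F-freeness
  -- loses 2εmn, while only (|K| + 2c)n + O(1) is available.
  · exfalso
    have hle := hmax _ hmem
    have hcardA : (A.card : ℝ) = n - m := by
      rw [eq_sub_iff_add_eq]; exact_mod_cast heq.symm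
    have hdA : (G.degSum A : ℝ) ≤ p * A.card ^ 2 + 2 * C := by
      refine degSum_le_of_abs_extremalNumber_sub_le hC fun h => hfree (h.induce_mono ?_)
      intro x hx hxS
      exact Finset.disjoint_left.1 hdisj hx hxS
    have hSn : (Sᶜ.card : ℝ) ≤ n := by
      have := Finset.card_le_univ Sᶜ
      rw [Fintype.card_fin] at this
      exact_mod_cast this
    have hdS : (G.degSum Finset.univ : ℝ) ≤ G.degSum Sᶜ + 2 * c * n := by
      have := G.degSum_le_sdiff Finset.univ S (d := n) (by positivity) fun x _ => by
        have : G.degOn Finset.univ x ≤ n := by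
          have := (G.degree_lt_card_verts x).le
          rwa [Fintype.card_fin, ← degOn_univ] at this
        exact_mod_cast this
      rw [← Finset.compl_eq_univ_sdiff] at this
      have hS' : (S.card : ℝ) ≤ c := by exact_mod_cast hS
      have : (S.card : ℝ) * n ≤ c * n := by gcongr
      linarith
    have hprod : 2 * (p - ε) * n * Sᶜ.card ≤ 2 * (p - ε) * n * n := by
      have : 0 ≤ 2 * (p - ε) * n := by
        have := sub_nonneg.2 hεp
        positivity
      gcongr
    simp only [φ, hcardA] at hle hdA
    have hKn : K * n ≤ |K| * n := by gcongr; exact le_abs_self K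
    have hmn : (|K| + 2 * c + 1) * n ≤ ε * m * n := by gcongr
    have hpos : 0 ≤ (|K| + 2 * c) * (n : ℝ) := by positivity
    nlinarith

/-- A graph with many edges in which few vertices meet all copies of `F` has a vertex of large
degree. -/
lemma exists_le_degOn (hp : p < 1) (hp0 : 0 ≤ p)
    (hC : ∀ n : ℕ, |(extremalNumber n F : ℝ) - p * n ^ 2 / 2| ≤ C) (c : ℕ) (K : ℝ) :
    ∃ ε : ℝ, 0 < ε ∧ ε ≤ 1 ∧ ∀ᶠ n : ℕ in atTop, ∀ G : SimpleGraph (Fin n),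
      p * n ^ 2 + 2 * (1 - p) * n - K ≤ G.degSum Finset.univ →
      ∀ S : Finset (Fin n), S.card ≤ c → F.Free (G.induce ((S : Set (Fin n))ᶜ)) →
      ∃ v, (p + ε) * n ≤ G.degOn Finset.univ v := by
  classical
  have hp' : 0 < 1 - p := by linarith
  have hc : (0 : ℝ) < 2 * (c + 1) := by positivity
  refine ⟨(1 - p) / (2 * (c + 1)), by positivity, ?_, ?_⟩
  · rw [div_le_one hc]
    have : (0 : ℝ) ≤ c := by positivity
    linarith
  -- If all degrees were below (p+ε)n, the degree sum would be at most pn² + 2cεn + O(1); here 2cε ≤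
  -- 1 - p, half of the surplus 2(1-p).
  set ε := (1 - p) / (2 * (c + 1)) with hε
  have hεc : c * ε ≤ (1 - p) / 2 := by
    rw [hε, mul_div_assoc', div_le_div_iff₀ hc two_pos]
    nlinarith
  have hε0 : 0 < ε := by positivity
  filter_upwards [tendsto_natCast_atTop_atTop.eventually_gt_atTop
    ((p * c ^ 2 + 2 * C + K) / (1 - p))] with n hn G hG S hS hfree
  rw [div_lt_iff₀ hp'] at hn
  by_contra! hdeg
  have h1 := G.degSum_le_sdiff Finset.univ S (d := (p + ε) * n) (by positivity)
    fun x _ => (hdeg x).le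
  rw [← Finset.compl_eq_univ_sdiff] at h1
  have h2 : (G.degSum Sᶜ : ℝ) ≤ p * Sᶜ.card ^ 2 + 2 * C :=
    degSum_le_of_abs_extremalNumber_sub_le hC (by rwa [Finset.coe_compl])
  have h3 : (Sᶜ.card : ℝ) = n - S.card := by
    have := Finset.card_add_card_compl S
    rw [Fintype.card_fin] at this
    rw [eq_sub_iff_add_eq, add_comm]
    exact_mod_cast this
  have hS' : (S.card : ℝ) ≤ c := by exact_mod_cast hS
  have h4 : (S.card : ℝ) * (ε * n) ≤ c * (ε * n) := by gcongr
  have h5 : c * ε * n ≤ (1 - p) / 2 * n := by gcongr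
  have h6 : p * (S.card : ℝ) ^ 2 ≤ p * c ^ 2 := by gcongr
  rw [h3] at h2
  nlinarith


/-- A vertex of degree larger than the typical one lies in copies of `F` avoiding any given bounded
set of other vertices. -/
lemma eventually_isContained_induce_compl {r : ℕ} (hr : 2 ≤ r) {C : ℝ}
    (hC : ∀ n : ℕ, |(extremalNumber n F : ℝ) - (1 - 1 / r) * n ^ 2 / 2| ≤ C) {ε : ℝ} (hε : 0 < ε)
    (hε1 : ε ≤ 1) (c : ℕ) (K : ℝ) :
    ∀ᶠ n : ℕ in atTop, ∀ G : SimpleGraph (Fin n),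
      (1 - 1 / r) * n ^ 2 - K * n ≤ (G.degSum Finset.univ : ℝ) →
      ∀ S : Finset (Fin n), S.card ≤ c → F.Free (G.induce ((S : Set (Fin n))ᶜ)) →
      ∀ R : Finset (Fin n), R.card ≤ c → ∀ v ∉ R,
      (1 - 1 / r + ε) * n ≤ (G.degOn Finset.univ v : ℝ) →
      F ⊑ G.induce ((R : Set (Fin n))ᶜ) := by
  classical
  -- Beating density 1 - 1/s among the neighbours of v yields s + 1 = r parts.
  obtain ⟨s, rfl⟩ : ∃ s, r = s + 1 := ⟨r - 1, by omega⟩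
  have hs1 : (1 : ℝ) ≤ s := by exact_mod_cast (by omega : 1 ≤ s)
  have hs : (0 : ℝ) < s := by linarith
  obtain ⟨t, ht⟩ := exists_isContained_graphJoin_completeEquipartiteGraph (by omega) hC
  set p : ℝ := 1 - 1 / (s + 1 : ℕ) with hp
  have hp' : p = s / (s + 1) := by rw [hp]; push_cast; field_simp; ring
  have hp1 : p ≤ 1 := by rw [hp']; exact (div_le_one (by positivity)).2 (by linarith)
  have hp2 : 1 / 2 ≤ p := by
    rw [hp', div_le_div_iff₀ two_pos (by positivity)]; linarith
  set δ : ℝ := ε / (8 * s) with hδ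
  have hδ0 : 0 < δ := by positivity
  have hδs : δ * s = ε / 8 := by rw [hδ]; field_simp
  have hδε : δ ≤ ε / 8 := by nlinarith
  obtain ⟨N, hN⟩ := exists_completeEquipartiteGraph_isContained_induce s t hδ0
  -- The bound 2c accommodates S ∪ R, so that A avoids R as well.
  obtain ⟨m, hm⟩ := exists_subset_forall_le_degOn hC hδ0 (by linarith) (2 * c) K
  filter_upwards [hm, tendsto_natCast_atTop_atTop.eventually_ge_atTop (2 * m / ε),
    tendsto_natCast_atTop_atTop.eventually_ge_atTop (2 * N : ℝ)]
    with n hn hnm hnN G hG S hS hfree R hR v hv hdeg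
  rw [div_le_iff₀ hε] at hnm
  obtain ⟨A, hAdisj, hAcard, hA⟩ := hn G hG (S ∪ R) ((Finset.card_union_le _ _).trans (by omega))
    fun h => hfree <| h.induce_mono <| Set.compl_subset_compl.2 <| by
      exact_mod_cast Finset.subset_union_left
  let B := A.filter (G.Adj v)
  have hBcard : B.card = G.degOn A v := by
    rw [degOn]
  have hBm : (G.degOn Finset.univ v : ℝ) ≤ B.card + m := by
    have h1 := G.degOn_le_add_card_sdiff Finset.univ A v
    rw [← Finset.compl_eq_univ_sdiff] at h1
    have h2 := Finset.card_add_card_compl A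
    rw [Fintype.card_fin] at h2
    rw [hBcard]
    exact_mod_cast (by omega : G.degOn Finset.univ v ≤ G.degOn A v + m)
  have hB : (p + ε / 2) * n ≤ B.card := by linarith
  have hBN : N ≤ B.card := by
    have : (N : ℝ) ≤ B.card := by nlinarith
    exact_mod_cast this
  have hBdeg (x) (hx : x ∈ B) : (1 - 1 / s + δ) * B.card ≤ (G.degOn B x : ℝ) := by
    have h1 := G.degOn_le_add_card_sdiff A B x
    have h2 : (A \ B).card + B.card ≤ n := by
      rw [Finset.card_sdiff_add_card_eq_card (Finset.filter_subset _ _)]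
      simpa using A.card_le_univ
    have h3 : (G.degOn A x : ℝ) + B.card ≤ G.degOn B x + n := by
      exact_mod_cast (by omega : G.degOn A x + B.card ≤ G.degOn B x + n)
    have h4 := hA x (Finset.mem_filter.1 hx).1
    -- A vertex of A has at most (1-p+δ)n non-neighbours in A. Since p/s = 1 - p and ε/(2s) = 4δ,
    -- the lower bound on |B| leaves room for the density gain δ.
    have h5 : (1 - p + δ) * n ≤ (1 / s - δ) * B.card := by
      have h6 : 0 ≤ 1 / s - δ := by
        rw [sub_nonneg, le_div_iff₀ hs]; linarith
      have h7 : 1 - p + δ ≤ (1 / s - δ) * (p + ε / 2) := by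
        have h8 : 1 / s * p = 1 - p := by rw [hp']; field_simp; ring
        have h9 : 1 / s * (ε / 2) = 4 * δ := by rw [hδ]; field_simp; norm_num
        have h10 : δ * (p + ε / 2) ≤ δ * 2 := by gcongr; linarith
        linarith
      calc (1 - p + δ) * n ≤ (1 / s - δ) * (p + ε / 2) * n := by gcongr
        _ = (1 / s - δ) * ((p + ε / 2) * n) := by ring
        _ ≤ _ := by gcongr
    linarith
  have hJ := graphJoin_one_isContained_induce_insert (G := G) (v := v)
    (fun x hx => (Finset.mem_filter.1 hx).2) (hN _ G B hBN hBdeg)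
  refine (ht.trans hJ).induce_mono fun x hx hxR => ?_
  rcases hx with rfl | hx
  · exact hv hxR
  · exact Finset.disjoint_left.1 hAdisj (Finset.mem_filter.1 hx).1 (Finset.mem_union_right _ hxR)

/-! ### Peeling off one dominating vertex. -/

/-- A dense graph without `j + 2` disjoint copies of `F` has a vertex meeting all families of
`j + 1` disjoint copies. -/
lemma eventually_exists_free_induce_compl_singleton [Finite W] {r : ℕ} (hr : 2 ≤ r) {C : ℝ}
    (hC : ∀ n : ℕ, |(extremalNumber n F : ℝ) - (1 - 1 / r) * n ^ 2 / 2| ≤ C) (j : ℕ) :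
    ∀ᶠ n : ℕ in atTop, ∀ (G : SimpleGraph (Fin n)) [DecidableRel G.Adj],
      (disjointCopies (j + 2) F).Free G →
      n - 1 + extremalNumber (n - 1) (disjointCopies (j + 1) F) ≤ G.edgeFinset.card →
      ∃ v, (disjointCopies (j + 1) F).Free (G.induce {v}ᶜ) := by
  classical
  have := Fintype.ofFinite W
  have hr' : (1 : ℝ) < r := by exact_mod_cast hr
  have hp0 : 0 ≤ 1 - 1 / (r : ℝ) := by
    rw [sub_nonneg]; exact (div_le_one (by linarith)).2 hr'.le
  have hp1 : 1 - 1 / (r : ℝ) < 1 := by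
    have : 0 < 1 / (r : ℝ) := by positivity
    linarith
  have hC0 : 0 ≤ C := (abs_nonneg _).trans (hC 0)
  let c := (j + 2) * Fintype.card W
  obtain ⟨ε, hε, hε1, h1⟩ := exists_le_degOn hp1 hp0 hC c (2 * C + 2)
  filter_upwards [h1, eventually_isContained_induce_compl hr hC hε hε1 c (2 * C + 2),
    eventually_ge_atTop 1] with n h1 h2 hn G _ hfree hcard
  have hn' : (1 : ℝ) ≤ n := by exact_mod_cast hn
  set p := 1 - 1 / (r : ℝ)
  have hG : p * n ^ 2 + 2 * (1 - p) * n - (2 * C + 2) ≤ G.degSum Finset.univ := by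
    have h3 : extremalNumber (n - 1) F ≤ extremalNumber (n - 1) (disjointCopies (j + 1) F) :=
      (isContained_disjointCopies_succ j).extremalNumber_le
    have h4 : (n : ℝ) - 1 + extremalNumber (n - 1) F ≤ G.edgeFinset.card := by
      rw [← Nat.cast_pred hn]
      exact_mod_cast (Nat.add_le_add_left h3 _).trans hcard
    have h5 := (abs_le.1 (hC (n - 1))).1
    rw [Nat.cast_pred hn] at h5
    rw [degSum_univ]
    push_cast
    linarith
  obtain ⟨S, hSc, hS⟩ := exists_finset_free_induce_compl (F := F) (G := G) (j + 2) Set.univ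
    fun h => hfree (h.trans (Copy.induce G _).isContained)
  rw [← Set.compl_eq_univ_sdiff] at hS
  obtain ⟨v, hv⟩ := h1 G hG S hSc hS
  refine ⟨v, fun hcop => hfree ?_⟩
  -- R carries j + 1 copies and misses v, so the large degree of v supplies one more copy outside R.
  obtain ⟨R, hRv, hRc, hR⟩ := hcop.exists_finset
  have hRc' : R.card ≤ c := hRc.trans <| by
    rw [Fintype.card_prod, Fintype.card_fin]
    exact Nat.mul_le_mul_right _ (by omega)
  have hvR : v ∉ R := fun h => hRv h rfl
  refine disjointCopies_succ_isContained disjoint_compl_left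
    (h2 G ?_ S hSc hS R hRc' v hvR hv) hR
  nlinarith

lemma mem_extremalGraphs_iff {n : ℕ} {G : SimpleGraph (Fin n)} [DecidableRel G.Adj] :
    G ∈ extremalGraphs n F ↔ F.Free G ∧ G.edgeFinset.card = extremalNumber n F := by
  have h := isExtremal_free_iff (G := G) (H := F)
  rw [Fintype.card_fin] at h
  rw [← h]
  unfold extremalGraphs
  rw [Set.mem_ofPred_eq]
  congr!

/-- The extremal graphs for `j + 2` disjoint copies of `F` are the joins of a vertex and an
extremal graph for `j + 1` disjoint copies. -/
lemma eventually_mem_extremalGraphs_iff [Finite W] {r : ℕ} (hr : 2 ≤ r) {C : ℝ}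
    (hC : ∀ n : ℕ, |(extremalNumber n F : ℝ) - (1 - 1 / r) * n ^ 2 / 2| ≤ C) (hF : F ≠ ⊥) (j : ℕ) :
    ∀ᶠ n : ℕ in atTop, ∀ G : SimpleGraph (Fin n),
      G ∈ extremalGraphs n (disjointCopies (j + 2) F) ↔
        ∃ H ∈ extremalGraphs (n - 1) (disjointCopies (j + 1) F),
          Nonempty (G ≃g graphJoin (⊤ : SimpleGraph (Fin 1)) H) := by
  classical
  filter_upwards [eventually_exists_free_induce_compl_singleton hr hC j, eventually_ge_atTop 1]
    with n hn hn1 G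
  have hjoin (G : SimpleGraph (Fin n)) [DecidableRel G.Adj] (H : SimpleGraph (Fin (n - 1)))
      (hH : H ∈ extremalGraphs (n - 1) (disjointCopies (j + 1) F))
      (e : G ≃g graphJoin (⊤ : SimpleGraph (Fin 1)) H) :
      (disjointCopies (j + 2) F).Free G ∧
        G.edgeFinset.card = n - 1 + extremalNumber (n - 1) (disjointCopies (j + 1) F) := by
    rw [mem_extremalGraphs_iff] at hH
    refine ⟨fun h => ?_, ?_⟩
    · obtain ⟨v, -, ⟨e'⟩⟩ := nonempty_iso_graphJoin_one_iff.1 ⟨e⟩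
      exact hH.1 ((disjointCopies_isContained_induce_compl_singleton h v).trans e'.isContained)
    · rw [card_edgeFinset_of_iso_graphJoin_one e, hH.2, Fintype.card_fin, add_comm]
  have hdel (G : SimpleGraph (Fin n)) [DecidableRel G.Adj]
      (hfree : (disjointCopies (j + 2) F).Free G)
      (hcard : n - 1 + extremalNumber (n - 1) (disjointCopies (j + 1) F) ≤ G.edgeFinset.card) :
      G.edgeFinset.card = n - 1 + extremalNumber (n - 1) (disjointCopies (j + 1) F) ∧
        ∃ H ∈ extremalGraphs (n - 1) (disjointCopies (j + 1) F),
          Nonempty (G ≃g graphJoin (⊤ : SimpleGraph (Fin 1)) H) := by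
    obtain ⟨v, hv⟩ := hn G hfree hcard
    have hV : Fintype.card ({v}ᶜ : Set (Fin n)) = n - 1 := by
      rw [Fintype.card_compl_set]; simp
    have h1 := card_edgeFinset_le_extremalNumber hv
    rw [hV] at h1
    have h2 := card_edgeFinset_eq_induce_add_degree G v
    have h3 := G.degree_lt_card_verts v
    rw [Fintype.card_fin] at h3
    -- The bounds e(G-v) ≤ ex(n-1, (j+1)F) and deg v ≤ n - 1 sum to the assumed lower bound on e(G),
    -- so both are equalities.
    refine ⟨by omega, (G.induce {v}ᶜ).overFin hV, ?_, ?_⟩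
    · rw [mem_extremalGraphs_iff, ← ((G.induce {v}ᶜ).overFinIso hV).card_edgeFinset_eq]
      exact ⟨fun h => hv (h.trans ((G.induce {v}ᶜ).overFinIso hV).isContained'), by omega⟩
    · refine nonempty_iso_graphJoin_one_iff.2 ⟨v, (degree_eq_card_sub_one_iff G v).1 ?_,
        ⟨(G.induce {v}ᶜ).overFinIso hV⟩⟩
      rw [Fintype.card_fin]
      omega
  -- An edge guarantees that the empty graph is free, so that an extremal graph exists.
  have hFj : disjointCopies (j + 1) F ≠ ⊥ := by
    obtain ⟨a, b, hab⟩ := ne_bot_iff_exists_adj.1 hF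
    exact ne_bot_iff_exists_adj.2 ⟨(0, a), (0, b), rfl, hab⟩
  have hex : extremalNumber n (disjointCopies (j + 2) F) =
      n - 1 + extremalNumber (n - 1) (disjointCopies (j + 1) F) := by
    apply le_antisymm
    · have hle := (extremalNumber_le_iff (V := Fin n) (disjointCopies (j + 2) F)
        (n - 1 + extremalNumber (n - 1) (disjointCopies (j + 1) F))).2 fun G _ hG =>
          (le_total _ _).elim id fun h => (hdel G hG h).1.le
      rwa [Fintype.card_fin] at hle
    · obtain ⟨H, _, hH⟩ := exists_isExtremal_free (V := Fin (n - 1)) hFj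
      have hH' : H ∈ extremalGraphs (n - 1) (disjointCopies (j + 1) F) := by
        rw [mem_extremalGraphs_iff]
        simpa using isExtremal_free_iff.1 hH
      have hV : Fintype.card (Fin 1 ⊕ Fin (n - 1)) = n := by simp; omega
      obtain ⟨hG, hGc⟩ := hjoin _ H hH'
        ((graphJoin (⊤ : SimpleGraph (Fin 1)) H).overFinIso hV).symm
      have hle := card_edgeFinset_le_extremalNumber hG
      rwa [hGc, Fintype.card_fin] at hle
  rw [mem_extremalGraphs_iff, hex]
  exact ⟨fun h => (hdel G h.1 h.2.ge).2, fun ⟨H, hH, ⟨e⟩⟩ => hjoin G H hH e⟩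

lemma extremalGraphs_congr {W' : Type*} {F' : SimpleGraph W'} (e : F ≃g F') (n : ℕ) :
    extremalGraphs n F = extremalGraphs n F' := by
  classical
  ext G
  rw [mem_extremalGraphs_iff, mem_extremalGraphs_iff, extremalNumber_congr_right e,
    free_congr_left e]

/-- A graph with quadratic extremal number has an edge. -/
lemma ne_bot_of_abs_extremalNumber_sub_le [Finite W] {p C : ℝ} (hp : 0 < p)
    (hC : ∀ n : ℕ, |(extremalNumber n F : ℝ) - p * n ^ 2 / 2| ≤ C) : F ≠ ⊥ := by
  rintro rfl
  have := Fintype.ofFinite W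
  -- Once n ≥ |W| no graph is free of the edgeless one, and the extremal number takes the default
  -- value 0.
  have h0 (n : ℕ) (hn : Fintype.card W ≤ n) : extremalNumber n (⊥ : SimpleGraph W) = 0 := by
    rw [← Nat.le_zero, ← Fintype.card_fin n, extremalNumber_le_iff]
    exact fun G _ h => absurd (bot_isContained_iff_card_le.2 (by simpa using hn)) h
  obtain ⟨n, hn⟩ := exists_nat_gt (max (Fintype.card W + 1 : ℝ) (2 * C / p))
  have hn1 : (Fintype.card W + 1 : ℝ) < n := (le_max_left _ _).trans_lt hn
  have hn2 := (le_max_right _ _).trans_lt hn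
  rw [div_lt_iff₀ hp] at hn2
  have h1 : (1 : ℝ) ≤ n := by
    have : (0 : ℝ) ≤ Fintype.card W := by positivity
    linarith
  have h2 := (abs_le.1 (hC n)).1
  rw [h0 n (by exact_mod_cast (by linarith : (Fintype.card W : ℝ) ≤ n))] at h2
  have h3 : p * n ≤ p * n ^ 2 := by gcongr; nlinarith
  push_cast at h2
  linarith

end SimpleGraph

open SimpleGraph in
theorem theorem1p1 {W : Type*} [Finite W] (F : SimpleGraph W) (r k : ℕ) (hr : 2 ≤ r) (hk : 1 ≤ k)
    (hF : (fun n : ℕ => (SimpleGraph.extremalNumber n F : ℝ) -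
        ((SimpleGraph.turanGraph n r).edgeFinset.card : ℝ)) =O[atTop] (fun _ => (1 : ℝ))) :
    ∀ᶠ n : ℕ in atTop, ∀ G : SimpleGraph (Fin n),
      G ∈ SimpleGraph.extremalGraphs n (SimpleGraph.disjointCopies k F) ↔
        ∃ H ∈ SimpleGraph.extremalGraphs (n - (k - 1)) F,
          Nonempty (G ≃g SimpleGraph.graphJoin (⊤ : SimpleGraph (Fin (k - 1))) H) := by
  obtain ⟨C, hC⟩ := exists_forall_abs_extremalNumber_sub_le (by omega) hF
  have hbot : F ≠ ⊥ := ne_bot_of_abs_extremalNumber_sub_le (by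
    have : (1 : ℝ) < r := by exact_mod_cast hr
    rw [sub_pos]; exact (div_lt_one (by linarith)).2 this) hC
  suffices h : ∀ j : ℕ, ∀ᶠ n : ℕ in atTop, ∀ G : SimpleGraph (Fin n),
      G ∈ extremalGraphs n (disjointCopies (j + 1) F) ↔
        ∃ H ∈ extremalGraphs (n - j) F,
          Nonempty (G ≃g graphJoin (⊤ : SimpleGraph (Fin j)) H) by
    have := h (k - 1)
    rwa [Nat.sub_add_cancel hk] at this
  intro j
  induction j with
  | zero =>
    refine Eventually.of_forall fun n G => ?_
    rw [extremalGraphs_congr (disjointCopiesOneIso F)]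
    constructor
    · exact fun hG => ⟨G, hG, ⟨(graphJoinEmptyIso _ G).symm⟩⟩
    · rintro ⟨H, hH, ⟨e⟩⟩
      classical
      have e' : G ≃g H := e.trans (graphJoinEmptyIso _ H)
      rw [mem_extremalGraphs_iff] at hH ⊢
      rw [e'.card_edgeFinset_eq]
      exact ⟨fun h => hH.1 (h.trans e'.isContained), hH.2⟩
  | succ j ih =>
    -- One vertex is removed on n vertices and the induction hypothesis is applied on n - 1;
    -- associativity merges K_1 ∨ K_j into K_{j+1}.
    filter_upwards [eventually_mem_extremalGraphs_iff hr hC hbot j,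
      (tendsto_sub_atTop_nat 1).eventually ih, eventually_ge_atTop (j + 1)] with n h1 h2 hn G
    have assoc (H : SimpleGraph (Fin (n - (j + 1)))) :
        Nonempty (graphJoin (⊤ : SimpleGraph (Fin 1)) (graphJoin (⊤ : SimpleGraph (Fin j)) H) ≃g
          graphJoin (⊤ : SimpleGraph (Fin (j + 1))) H) :=
      ⟨(graphJoinAssoc _ _ _).symm.trans (graphJoinCongr (graphJoinTopFinIso j) Iso.refl)⟩
    have hsub : n - 1 - j = n - (j + 1) := by omega
    rw [hsub] at h2
    rw [h1]
    constructor
    · rintro ⟨H, hH, ⟨e⟩⟩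
      obtain ⟨H', hH', ⟨e'⟩⟩ := (h2 H).1 hH
      obtain ⟨a⟩ := assoc H'
      exact ⟨H', hH', ⟨(e.trans (graphJoinCongr Iso.refl e')).trans a⟩⟩
    · rintro ⟨H', hH', ⟨e⟩⟩
      have hV : Fintype.card (Fin j ⊕ Fin (n - (j + 1))) = n - 1 := by simp; omega
      let i := (graphJoin (⊤ : SimpleGraph (Fin j)) H').overFinIso hV
      obtain ⟨a⟩ := assoc H'
      exact ⟨_, (h2 _).2 ⟨H', hH', ⟨i.symm⟩⟩,
        ⟨(e.trans a.symm).trans (graphJoinCongr Iso.refl i)⟩⟩
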